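/- Fix $d\ge 1$ and let $\mathbf Z=(X,A,Y)$ have distribution $\mathbb P$ on $\{1,\dots,d\}\times\{0,1\}\times\{0,1\}$. Write $p_k=\mathbb P(X=k)$, $\pi_k=\mathbb P(A=1\mid X=k)$, $\mu_{ak}=\mathbb P(Y=1\mid X=k,A=a)$, and assume positivity: for some constant $\epsilon\in(0,1/2)$, $\epsilon\le\pi_k\le 1-\epsilon$ for every $k$ with $p_k>0$. Let $$\psi=\psi(\mathbb P)=\sum_{k=1}^d p_k(\mu_{1k}-\mu_{0k})$$ (the average treatment effect under the usual causal identification assumptions). Given i.i.d. copies $\mathbf Z_i=(X_i,A_i,Y_i)$, $i\ge 1$, of $\mathbf Z$, let $\widehat\psi=\sum_{k=1}^d\widehat p_k(\widehat\mu_{1k}-\widehat\mu_{0k})$ be the plug-in estimator from the first $n$ observations, where $$\widehat p_k=\frac{\#\{i\le n:X_i=k\}}{n},\qquad \widehat\mu_{ak}=\frac{\#\{i\le n:X_i=k,A_i=a,Y_i=1\}}{\#\{i\le n:X_i=k,A_i=a\}},\qquad 0/0:=0.$$ Then, as $n\to\infty$, $$\sqrt n\,(\widehat\psi-\psi)\xrightarrow{d}N\big(0,\operatorname{Var}(\varphi(\mathbf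 Z))\big),\qquad \varphi(\mathbf Z)=\mu_{1X}-\mu_{0X}+\Big(\frac{A}{\pi_X}-\frac{1-A}{1-\pi_X}\Big)(Y-\mu_{AX}).$$ Moreover, $\varphi$ is, up to centering, the efficient influence function of $\psi$ at $\mathbb P$ in the nonparametric model of all distributions on $\{1,\dots,d\}\times\{0,1\}\times\{0,1\}$. That is, $\mathbb E[\varphi(\mathbf Z)-\psi]=0$; for every family of distributions $(\mathbb P_t)_{t>0}$ in this model that is differentiable in quadratic mean at $\mathbb P$ as $t\downarrow 0$ with score $s$ one has $$\lim_{t\downarrow0}\frac{\psi(\mathbb P_t)-\psi(\mathbb P)}{t}=\mathbb E\big[(\varphi(\mathbf Z)-\psi)\,s(\mathbf Z)\big];$$ and $\varphi-\psi$ lies in the linear span of these scores. (In $\psi(\mathbb P_t)$, conditional probabilities given null events are read as $0$.) -/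

import Mathlib

open MeasureTheory ProbabilityTheory Filter Topology

namespace DiscreteATE

/-- The sample space of one observation `Z = (X, A, Y)`: a covariate with `d` categories, a binary
treatment and a binary outcome (`true` is `1`, `false` is `0`). -/
abbrev Obs (d : ℕ) : Type := Fin d × Bool × Bool

/-- The numerical value `0` or `1` of a binary variable. -/
def val (b : Bool) : ℝ := if b then 1 else 0

noncomputable section

/-! ### Parameters of the observed-data distribution `P` -/

/-- `p_k = P(X = k)`. -/
def pr {d : ℕ} (P : Measure (Obs d)) (k : Fin d) : ℝ :=
  P.real {z | z.1 = k}

/-- The propensity score `π_k = P(A = 1 | X = k)`. -/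
def propensity {d : ℕ} (P : Measure (Obs d)) (k : Fin d) : ℝ :=
  (P[|{z : Obs d | z.1 = k}]).real {z | z.2.1 = true}

/-- The regression function `μ_{ak} = P(Y = 1 | X = k, A = a)`. -/
def outcomeReg {d : ℕ} (P : Measure (Obs d)) (a : Bool) (k : Fin d) : ℝ :=
  (P[|{z : Obs d | z.1 = k ∧ z.2.1 = a}]).real {z | z.2.2 = true}

/-- The functional `ψ = ∑_k p_k (μ_{1k} - μ_{0k})`. -/
def ate {d : ℕ} (P : Measure (Obs d)) : ℝ :=
  ∑ k, pr P k * (outcomeReg P true k - outcomeReg P false k)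

/-- Positivity with constant `ε`: `π_k ∈ [ε, 1 - ε]` for every category of positive probability
(on the other categories `π_k` is not determined by `P`). -/
def Positivity {d : ℕ} (ε : ℝ) (P : Measure (Obs d)) : Prop :=
  ∀ k, 0 < pr P k → ε ≤ propensity P k ∧ propensity P k ≤ 1 - ε

/-- `φ(Z) = μ_{1X} - μ_{0X} + (A / π_X - (1 - A) / (1 - π_X)) (Y - μ_{AX})`. -/
def phi {d : ℕ} (P : Measure (Obs d)) (z : Obs d) : ℝ :=
  outcomeReg P true z.1 - outcomeReg P false z.1
    + (val z.2.1 / propensity P z.1 - (1 - val z.2.1) / (1 - propensity P z.1))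
      * (val z.2.2 - outcomeReg P z.2.1 z.1)

/-! ### Empirical averages and the plug-in estimator, for a sample `z` of size `n`

Division by zero is `0` in `ℝ`, which is the convention `0 / 0 = 0` for empty cells. -/

/-- `p̂_k = #{i : X_i = k} / n`. -/
def prHat {d n : ℕ} (z : Fin n → Obs d) (k : Fin d) : ℝ :=
  ((Finset.univ.filter fun i => (z i).1 = k).card : ℝ) / n

/-- `μ̂_{ak} = #{i : X_i = k, A_i = a, Y_i = 1} / #{i : X_i = k, A_i = a}`. -/
def outcomeRegHat {d n : ℕ} (z : Fin n → Obs d) (a : Bool) (k : Fin d) : ℝ :=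
  ((Finset.univ.filter fun i => (z i).1 = k ∧ (z i).2.1 = a ∧ (z i).2.2 = true).card : ℝ)
    / ((Finset.univ.filter fun i => (z i).1 = k ∧ (z i).2.1 = a).card : ℝ)

/-- The plug-in estimator `ψ̂ = ∑_k p̂_k (μ̂_{1k} - μ̂_{0k})`. -/
def ateHat {d n : ℕ} (z : Fin n → Obs d) : ℝ :=
  ∑ k, prHat z k * (outcomeRegHat z true k - outcomeRegHat z false k)

/-! ### Influence functions in the nonparametric model of all laws on `Obs d` -/

/-- `t ↦ Q t` (`t ↓ 0`) is a one-dimensional submodel through `P`, differentiable in quadratic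
mean with score `s`; densities are taken with respect to counting measure. -/
def IsSubmodel {d : ℕ} (P : Measure (Obs d)) (Q : ℝ → Measure (Obs d)) (s : Obs d → ℝ) : Prop :=
  (∀ t, IsProbabilityMeasure (Q t)) ∧
  Tendsto (fun t : ℝ => ∑ z : Obs d,
      ((√((Q t).real {z}) - √(P.real {z})) / t - s z / 2 * √(P.real {z})) ^ 2)
    (𝓝[>] 0) (𝓝 0)

/-- The tangent set of the nonparametric model at `P`: the scores of all submodels. -/
def tangentSet {d : ℕ} (P : Measure (Obs d)) : Set (Obs d → ℝ) :=
  {s | ∃ Q, IsSubmodel P Q s}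

/-- `f` is an influence function of the functional `T` at `P`: it has mean zero and represents the
derivative of `T` along every submodel. (All functions on `Obs d` are square integrable.) -/
def IsInfluenceFunction {d : ℕ} (T : Measure (Obs d) → ℝ) (P : Measure (Obs d))
    (f : Obs d → ℝ) : Prop :=
  ∫ z, f z ∂P = 0 ∧
  ∀ Q s, IsSubmodel P Q s →
    Tendsto (fun t : ℝ => (T (Q t) - T P) / t) (𝓝[>] 0) (𝓝 (∫ z, f z * s z ∂P))

/-- `f` is the efficient influence function: an influence function in the tangent space, which is
the linear span of the scores (closed, as `Obs d` is finite). -/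
def IsEfficientInfluenceFunction {d : ℕ} (T : Measure (Obs d) → ℝ) (P : Measure (Obs d))
    (f : Obs d → ℝ) : Prop :=
  IsInfluenceFunction T P f ∧ f ∈ Submodule.span ℝ (tangentSet P)

end

end DiscreteATE

open DiscreteATE

namespace DiscreteATE

noncomputable section

/-! ### The functional in terms of the cell masses -/

/-! Both `ate` and `ateHat` are one function, `∑ k, catEffect k`, evaluated at the vector of cell
masses of `P` and at the vector of cell frequencies. Where `pr P k > 0`, positivity keeps the
denominators away from zero, so `catEffect k` is differentiable at `mass P`, and its gradient is
exactly `phi P` (`hasFDerivAt_catEffect`). Asymptotic normality is then the delta method: the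
frequencies are tight at rate `√n` by Chebyshev, the linearization error vanishes in measure, and
the linear term is a centred average of `phi P`, to which the central limit theorem applies. The
derivative along a submodel is the chain rule with the same gradient (`IsSubmodel.tendsto_ate`).
Efficiency is automatic because every mean-zero function is a score (`mem_tangentSet`). Null
categories need separate care: samples almost surely avoid them, and a submodel gives them mass only
`o(t)`. -/

/-- The probability mass function of a measure on `Obs d`. -/
def mass {d : ℕ} (P : Measure (Obs d)) : Obs d → ℝ := fun z => P.real {z}

/-- The relative frequencies of the cells in a sample. -/
def freq {d n : ℕ} (z : Fin n → Obs d) : Obs d → ℝ :=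
  fun w => ((Finset.univ.filter fun i => z i = w).card : ℝ) / n

/-- The total mass of the cells with covariate `k` and treatment `a`. -/
def armMass {d : ℕ} (q : Obs d → ℝ) (k : Fin d) (a : Bool) : ℝ :=
  q (k, a, true) + q (k, a, false)

/-- The contribution of category `k` to the treatment effect, as a function of cell masses. -/
def catEffect {d : ℕ} (k : Fin d) (q : Obs d → ℝ) : ℝ :=
  (armMass q k true + armMass q k false) *
    (q (k, true, true) / armMass q k true - q (k, false, true) / armMass q k false)

lemma mass_nonneg {d : ℕ} (P : Measure (Obs d)) (z : Obs d) : 0 ≤ mass P z := measureReal_nonneg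

lemma sum_obs {d : ℕ} (f : Obs d → ℝ) :
    ∑ z, f z = ∑ k, (f (k, true, true) + f (k, true, false) +
      (f (k, false, true) + f (k, false, false))) := by
  simp [Fintype.sum_prod_type]

lemma measureReal_arm {d : ℕ} (P : Measure (Obs d)) [IsFiniteMeasure P] (k : Fin d) (a : Bool) :
    P.real {z | z.1 = k ∧ z.2.1 = a} = armMass (mass P) k a := by
  have h : ({z | z.1 = k ∧ z.2.1 = a} : Set (Obs d))
      = (({(k, a, true), (k, a, false)} : Finset (Obs d)) : Set (Obs d)) := by
    ext ⟨x, b, c⟩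
    cases c <;> simp
  rw [h, ← sum_measureReal_singleton, Finset.sum_insert (by simp), Finset.sum_singleton]
  rfl

lemma pr_eq_armMass {d : ℕ} (P : Measure (Obs d)) [IsFiniteMeasure P] (k : Fin d) :
    pr P k = armMass (mass P) k true + armMass (mass P) k false := by
  rw [← measureReal_arm, ← measureReal_arm, pr, ← measureReal_union]
  · congr 1
    ext ⟨x, b, c⟩
    cases b <;> simp
  · rw [Set.disjoint_left]
    rintro ⟨x, b, c⟩ h1 h2
    simp_all
  · exact MeasurableSet.of_discrete

lemma condReal_apply {d : ℕ} (P : Measure (Obs d)) (s t : Set (Obs d)) :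
    (P[|s]).real t = (P.real s)⁻¹ * P.real (s ∩ t) := by
  rw [measureReal_def, cond_apply MeasurableSet.of_discrete, ENNReal.toReal_mul,
    ENNReal.toReal_inv]
  rfl

lemma propensity_eq {d : ℕ} (P : Measure (Obs d)) [IsFiniteMeasure P] (k : Fin d) :
    propensity P k = armMass (mass P) k true /
      (armMass (mass P) k true + armMass (mass P) k false) := by
  rw [propensity, condReal_apply, ← pr_eq_armMass, ← measureReal_arm,
    pr, div_eq_inv_mul]
  rfl

lemma outcomeReg_eq {d : ℕ} (P : Measure (Obs d)) [IsFiniteMeasure P] (a : Bool) (k : Fin d) :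
    outcomeReg P a k = mass P (k, a, true) / armMass (mass P) k a := by
  rw [outcomeReg, condReal_apply, ← measureReal_arm, div_eq_inv_mul]
  congr 2
  ext ⟨x, b, c⟩
  simp [and_assoc]

lemma ate_eq_sum_catEffect {d : ℕ} (P : Measure (Obs d)) [IsFiniteMeasure P] :
    ate P = ∑ k, catEffect k (mass P) := by
  simp only [ate, catEffect, pr_eq_armMass, outcomeReg_eq]

lemma card_arm_div {d n : ℕ} (z : Fin n → Obs d) (k : Fin d) (a : Bool) :
    ((Finset.univ.filter fun i => (z i).1 = k ∧ (z i).2.1 = a).card : ℝ) / n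
      = armMass (freq z) k a := by
  simp only [armMass, freq, ← add_div, Finset.card_filter, Nat.cast_sum, ← Finset.sum_add_distrib]
  congr 1
  refine Finset.sum_congr rfl fun i _ => ?_
  obtain ⟨x, b, c⟩ := z i
  cases c <;> simp

lemma prHat_eq {d n : ℕ} (z : Fin n → Obs d) (k : Fin d) :
    prHat z k = armMass (freq z) k true + armMass (freq z) k false := by
  simp only [prHat, ← card_arm_div, ← add_div, Finset.card_filter, Nat.cast_sum,
    ← Finset.sum_add_distrib]
  congr 1
  refine Finset.sum_congr rfl fun i _ => ?_
  obtain ⟨x, b, c⟩ := z i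
  cases b <;> simp

lemma outcomeRegHat_eq {d n : ℕ} (z : Fin n → Obs d) (a : Bool) (k : Fin d) :
    outcomeRegHat z a k = freq z (k, a, true) / armMass (freq z) k a := by
  rcases Nat.eq_zero_or_pos n with rfl | hn
  · simp [outcomeRegHat, freq]
  have hn' : (n : ℝ) ≠ 0 := by positivity
  have h : (Finset.univ.filter fun i => z i = (k, a, true))
      = Finset.univ.filter fun i => (z i).1 = k ∧ (z i).2.1 = a ∧ (z i).2.2 = true := by
    ext i
    simp [Prod.ext_iff]
  rw [outcomeRegHat, ← card_arm_div, freq, h, div_div_div_cancel_right₀ hn']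

lemma ateHat_eq_sum_catEffect {d n : ℕ} (z : Fin n → Obs d) :
    ateHat z = ∑ k, catEffect k (freq z) := by
  simp only [ateHat, catEffect, prHat_eq, outcomeRegHat_eq]

/-- Both ratios lie in `[0, 1]`, also when they read `0 / 0`. This replaces differentiability at
null categories. -/
lemma abs_catEffect_le {d : ℕ} (k : Fin d) {q : Obs d → ℝ} (hq : ∀ z, 0 ≤ q z) :
    |catEffect k q| ≤ armMass q k true + armMass q k false := by
  have harm (a : Bool) : 0 ≤ armMass q k a := add_nonneg (hq _) (hq _)
  have hdiv (a : Bool) : 0 ≤ q (k, a, true) / armMass q k a ∧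
      q (k, a, true) / armMass q k a ≤ 1 :=
    ⟨div_nonneg (hq _) (harm a), div_le_one_of_le₀ (by simp [armMass, hq]) (harm a)⟩
  have hsum := add_nonneg (harm true) (harm false)
  rw [catEffect, abs_mul, abs_of_nonneg hsum]
  refine mul_le_of_le_one_right hsum (abs_le.2 ⟨?_, ?_⟩) <;>
    linarith [(hdiv true).1, (hdiv true).2, (hdiv false).1, (hdiv false).2]

/-! ### Differentiability on the categories of positive probability -/

/-- The categories of positive probability. -/
def posCat {d : ℕ} (P : Measure (Obs d)) : Finset (Fin d) :=
  open Classical in Finset.univ.filter fun k => 0 < pr P k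

lemma mem_posCat {d : ℕ} {P : Measure (Obs d)} {k : Fin d} : k ∈ posCat P ↔ 0 < pr P k := by
  simp [posCat]

/-- The treatment effect over the categories of positive probability. -/
def posEffect {d : ℕ} (P : Measure (Obs d)) (q : Obs d → ℝ) : ℝ :=
  ∑ k ∈ posCat P, catEffect k q

/-- The part of the linear functional `h ↦ ∑ z, φ z * h z` that belongs to category `k`. -/
def catDeriv {d : ℕ} (P : Measure (Obs d)) (k : Fin d) : (Obs d → ℝ) →L[ℝ] ℝ :=
  ∑ a : Bool, ∑ y : Bool, phi P (k, a, y) • ContinuousLinearMap.proj (k, a, y)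

/-- The linear functional `h ↦ ∑ z, φ z * h z`, over the categories of positive probability. -/
def posDeriv {d : ℕ} (P : Measure (Obs d)) : (Obs d → ℝ) →L[ℝ] ℝ :=
  ∑ k ∈ posCat P, catDeriv P k

lemma catDeriv_apply {d : ℕ} (P : Measure (Obs d)) (k : Fin d) (h : Obs d → ℝ) :
    catDeriv P k h = phi P (k, true, true) * h (k, true, true)
      + phi P (k, true, false) * h (k, true, false)
      + (phi P (k, false, true) * h (k, false, true)
      + phi P (k, false, false) * h (k, false, false)) := by
  simp [catDeriv]

lemma mass_eq_zero_of_pr_eq_zero {d : ℕ} {P : Measure (Obs d)} [IsFiniteMeasure P] {z : Obs d}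
    (h : pr P z.1 = 0) : mass P z = 0 :=
  measureReal_mono_null (by simp) h

/-- `posDeriv` omits the null categories, where `phi P` only has default values, so `h` has to
vanish there. -/
lemma posDeriv_apply {d : ℕ} (P : Measure (Obs d)) {h : Obs d → ℝ}
    (hh : ∀ z, pr P z.1 = 0 → h z = 0) : posDeriv P h = ∑ z, phi P z * h z := by
  rw [sum_obs, posDeriv, sum_apply]
  simp only [catDeriv_apply]
  refine Finset.sum_subset (Finset.subset_univ _) fun k _ hk => ?_
  have h0 : pr P k = 0 := le_antisymm (not_lt.1 (mt mem_posCat.2 hk)) measureReal_nonneg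
  simp [hh (k, _, _) h0]

lemma armMass_pos {d : ℕ} {P : Measure (Obs d)} [IsFiniteMeasure P] {ε : ℝ} (hε : 0 < ε)
    (hP : Positivity ε P) {k : Fin d} (hk : 0 < pr P k) (a : Bool) :
    0 < armMass (mass P) k a := by
  obtain ⟨h1, h2⟩ := hP k hk
  rw [propensity_eq, ← pr_eq_armMass] at h1 h2
  rw [le_div_iff₀ hk] at h1
  rw [div_le_iff₀ hk] at h2
  have h3 := pr_eq_armMass P k
  have h4 := mul_pos hε hk
  cases a <;> nlinarith

lemma phi_treated {d : ℕ} (P : Measure (Obs d)) (k : Fin d) (y : Bool) :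
    phi P (k, true, y) = outcomeReg P true k - outcomeReg P false k
      + (val y - outcomeReg P true k) / propensity P k := by
  simp only [phi, val, if_true]
  ring

lemma phi_control {d : ℕ} (P : Measure (Obs d)) (k : Fin d) (y : Bool) :
    phi P (k, false, y) = outcomeReg P true k - outcomeReg P false k
      - (val y - outcomeReg P false k) / (1 - propensity P k) := by
  simp only [phi, val, Bool.false_eq_true, if_false]
  ring

/-- Fails on null categories: there `propensity` defaults to `0`, so the sides are `1` and `0`. -/
lemma one_sub_propensity_eq {d : ℕ} (P : Measure (Obs d)) [IsFiniteMeasure P] {k : Fin d}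
    (hk : 0 < pr P k) : 1 - propensity P k = armMass (mass P) k false /
      (armMass (mass P) k true + armMass (mass P) k false) := by
  rw [pr_eq_armMass] at hk
  rw [propensity_eq]
  field_simp
  ring

/-- Euler's identity: `catEffect k` is homogeneous of degree one in the masses. Hence `phi P` has
mean `ate P`. -/
lemma catDeriv_mass {d : ℕ} {P : Measure (Obs d)} [IsFiniteMeasure P] {k : Fin d}
    (hk : 0 < pr P k) (ha : ∀ a, 0 < armMass (mass P) k a) :
    catDeriv P k (mass P) = catEffect k (mass P) := by
  have h1 := ha true
  have h0 := ha false
  rw [catDeriv_apply, phi_treated, phi_treated, phi_control, phi_control,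
    one_sub_propensity_eq P hk, propensity_eq, outcomeReg_eq, outcomeReg_eq, catEffect]
  simp only [armMass, val] at *
  have h : 0 < mass P (k, true, true) + mass P (k, true, false) +
    (mass P (k, false, true) + mass P (k, false, false)) := by positivity
  simp only [if_true, Bool.false_eq_true, if_false]
  field_simp
  ring

lemma hasFDerivAt_catEffect {d : ℕ} {P : Measure (Obs d)} [IsFiniteMeasure P] {k : Fin d}
    (hk : 0 < pr P k) (ha : ∀ a, 0 < armMass (mass P) k a) :
    HasFDerivAt (catEffect k) (catDeriv P k) (mass P) := by
  have hproj (z : Obs d) : HasFDerivAt (fun q : Obs d → ℝ => q z)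
      (ContinuousLinearMap.proj (R := ℝ) (φ := fun _ : Obs d => ℝ) z) (mass P) :=
    (ContinuousLinearMap.proj (R := ℝ) (φ := fun _ : Obs d => ℝ) z).hasFDerivAt
  have harm (a : Bool) := (hproj (k, a, true)).fun_add (hproj (k, a, false))
  have hinv (a : Bool) := (hasDerivAt_inv (ha a).ne').comp_hasFDerivAt (mass P) (harm a)
  have hreg (a : Bool) := (hproj (k, a, true)).fun_mul (hinv a)
  have key := ((harm true).fun_add (harm false)).fun_mul ((hreg true).fun_sub (hreg false))
  refine (key.congr_fderiv ?_).congr_of_eventuallyEq (.of_forall fun q => by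
    simp [catEffect, armMass, div_eq_mul_inv])
  ext h
  have h1 := ha true
  have h0 := ha false
  rw [catDeriv_apply, phi_treated, phi_treated, phi_control, phi_control,
    one_sub_propensity_eq P hk, propensity_eq, outcomeReg_eq, outcomeReg_eq]
  simp only [armMass, val] at *
  have h : 0 < mass P (k, true, true) + mass P (k, true, false) +
    (mass P (k, false, true) + mass P (k, false, false)) := by positivity
  simp
  field_simp
  ring

lemma hasFDerivAt_posEffect {d : ℕ} {P : Measure (Obs d)} [IsFiniteMeasure P]
    (ha : ∀ k, 0 < pr P k → ∀ a, 0 < armMass (mass P) k a) :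
    HasFDerivAt (posEffect P) (posDeriv P) (mass P) :=
  HasFDerivAt.fun_sum fun k hk =>
    hasFDerivAt_catEffect (mem_posCat.1 hk) (ha k (mem_posCat.1 hk))

/-- Categories in which all masses vanish do not contribute to the treatment effect. -/
lemma sum_catEffect_eq_posEffect {d : ℕ} (P : Measure (Obs d)) {q : Obs d → ℝ}
    (hq : ∀ z, pr P z.1 = 0 → q z = 0) : ∑ k, catEffect k q = posEffect P q := by
  refine (Finset.sum_subset (Finset.subset_univ _) fun k _ hk => ?_).symm
  have h0 : pr P k = 0 := le_antisymm (not_lt.1 (mt mem_posCat.2 hk)) measureReal_nonneg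
  simp [catEffect, armMass, hq (k, _, _) h0]

lemma ate_eq_posEffect {d : ℕ} (P : Measure (Obs d)) [IsFiniteMeasure P] :
    ate P = posEffect P (mass P) := by
  rw [ate_eq_sum_catEffect, sum_catEffect_eq_posEffect P fun z => mass_eq_zero_of_pr_eq_zero]

lemma posDeriv_mass {d : ℕ} {P : Measure (Obs d)} [IsFiniteMeasure P]
    (ha : ∀ k, 0 < pr P k → ∀ a, 0 < armMass (mass P) k a) :
    posDeriv P (mass P) = ate P := by
  rw [ate_eq_posEffect, posDeriv, sum_apply, posEffect]
  exact Finset.sum_congr rfl fun k hk =>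
    catDeriv_mass (mem_posCat.1 hk) (ha k (mem_posCat.1 hk))

lemma integral_phi {d : ℕ} {P : Measure (Obs d)} [IsFiniteMeasure P]
    (ha : ∀ k, 0 < pr P k → ∀ a, 0 < armMass (mass P) k a) :
    ∫ z, phi P z ∂P = ate P := by
  rw [← posDeriv_mass ha, posDeriv_apply P fun z => mass_eq_zero_of_pr_eq_zero,
    integral_fintype .of_finite]
  simp [mass, mul_comm]

/-! ### Influence functions -/

lemma sum_mass {d : ℕ} (P : Measure (Obs d)) [IsProbabilityMeasure P] : ∑ z, mass P z = 1 := by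
  simp [mass]

lemma integral_eq_sum_mass {d : ℕ} (P : Measure (Obs d)) [IsFiniteMeasure P] (f : Obs d → ℝ) :
    ∫ z, f z ∂P = ∑ z, f z * mass P z := by
  rw [integral_fintype .of_finite]
  simp [mass, mul_comm]

/-- Differentiability in quadratic mean implies differentiability of the cell masses. -/
lemma IsSubmodel.tendsto_mass {d : ℕ} {P : Measure (Obs d)} {Q : ℝ → Measure (Obs d)}
    {s : Obs d → ℝ} (h : IsSubmodel P Q s) (z : Obs d) :
    Tendsto (fun t : ℝ => (mass (Q t) z - mass P z) / t) (𝓝[>] 0) (𝓝 (s z * mass P z)) := by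
  have hsq : Tendsto (fun t : ℝ =>
      ((√(mass (Q t) z) - √(mass P z)) / t - s z / 2 * √(mass P z)) ^ 2) (𝓝[>] 0) (𝓝 0) := by
    refine squeeze_zero (fun t => sq_nonneg _) (fun t => ?_) h.2
    exact Finset.single_le_sum (f := fun z => ((√((Q t).real {z}) - √(P.real {z})) / t
      - s z / 2 * √(P.real {z})) ^ 2) (fun _ _ => sq_nonneg _) (Finset.mem_univ z)
  have hdiff : Tendsto (fun t : ℝ => (√(mass (Q t) z) - √(mass P z)) / t) (𝓝[>] 0)
      (𝓝 (s z / 2 * √(mass P z))) := by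
    rw [tendsto_iff_norm_sub_tendsto_zero]
    simpa [Real.sqrt_sq_eq_abs] using hsq.sqrt
  have hpos : ∀ᶠ t : ℝ in 𝓝[>] 0, 0 < t := eventually_mem_nhdsWithin
  have hid : Tendsto (fun t : ℝ => t) (𝓝[>] 0) (𝓝 0) := tendsto_nhdsWithin_of_tendsto_nhds tendsto_id
  have hroot : Tendsto (fun t : ℝ => √(mass (Q t) z)) (𝓝[>] 0) (𝓝 (√(mass P z))) := by
    have := (hdiff.mul hid).add_const (√(mass P z))
    rw [mul_zero, zero_add] at this
    refine this.congr' (hpos.mono fun t ht => ?_)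
    rw [div_mul_cancel₀ _ ht.ne', sub_add_cancel]
  -- Difference of squares: `q - p = (√q - √p) * (√q + √p)`.
  have := hdiff.mul (hroot.add_const (√(mass P z)))
  have hlim : s z / 2 * √(mass P z) * (√(mass P z) + √(mass P z)) = s z * mass P z := by
    linear_combination s z * Real.mul_self_sqrt (mass_nonneg P z)
  rw [hlim] at this
  refine this.congr fun t => ?_
  rw [div_mul_eq_mul_div]
  congr 1
  linear_combination Real.mul_self_sqrt (mass_nonneg (Q t) z)
    - Real.mul_self_sqrt (mass_nonneg P z)

/-- Scores have mean zero. -/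
lemma IsSubmodel.sum_score {d : ℕ} {P : Measure (Obs d)} [IsProbabilityMeasure P]
    {Q : ℝ → Measure (Obs d)} {s : Obs d → ℝ} (h : IsSubmodel P Q s) :
    ∑ z, s z * mass P z = 0 := by
  have hsum := tendsto_finsetSum Finset.univ fun z _ => h.tendsto_mass z
  refine tendsto_nhds_unique hsum (tendsto_const_nhds.congr fun t => ?_)
  have := h.1 t
  rw [← Finset.sum_div, Finset.sum_sub_distrib, sum_mass, sum_mass, sub_self, zero_div]

/-- The treatment effect is differentiable along every submodel, with gradient `phi P`. -/
lemma IsSubmodel.tendsto_ate {d : ℕ} {P : Measure (Obs d)} [IsProbabilityMeasure P]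
    (ha : ∀ k, 0 < pr P k → ∀ a, 0 < armMass (mass P) k a)
    {Q : ℝ → Measure (Obs d)} {s : Obs d → ℝ} (h : IsSubmodel P Q s) :
    Tendsto (fun t : ℝ => (ate (Q t) - ate P) / t) (𝓝[>] 0)
      (𝓝 (∑ z, phi P z * (s z * mass P z))) := by
  have hpos : ∀ᶠ t : ℝ in 𝓝[>] 0, 0 < t := eventually_mem_nhdsWithin
  have hid : Tendsto (fun t : ℝ => t) (𝓝[>] 0) (𝓝 0) := tendsto_nhdsWithin_of_tendsto_nhds tendsto_id
  have hmass : Tendsto (fun t : ℝ => t⁻¹ • (mass (Q t) - mass P)) (𝓝[>] 0)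
      (𝓝 fun z => s z * mass P z) := by
    rw [tendsto_pi_nhds]
    intro z
    exact (h.tendsto_mass z).congr fun t => by simp [div_eq_inv_mul]
  have hsub : Tendsto (fun t : ℝ => mass (Q t) - mass P) (𝓝[>] 0) (𝓝 0) := by
    have := hid.smul hmass
    rw [zero_smul] at this
    exact this.congr' (hpos.mono fun t ht => smul_inv_smul₀ ht.ne' _)
  -- Chain rule along the curve `mass (Q t)`, with scaling `t⁻¹` and limiting direction `s * mass
  -- P`.
  have hmain := (hasFDerivAt_posEffect ha).hasFDerivWithinAt.lim (s := Set.univ) hsub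
    (.of_forall fun _ => Set.mem_univ _) hmass
  -- `Q t` may charge null categories, without any positivity. Their masses have derivative `s z * 0
  -- = 0`, and they dominate the effect.
  have hnull : Tendsto (fun t : ℝ => ∑ k ∈ (posCat P)ᶜ, catEffect k (mass (Q t)) / t) (𝓝[>] 0)
      (𝓝 0) := by
    suffices ∀ k ∈ (posCat P)ᶜ, Tendsto (fun t : ℝ => catEffect k (mass (Q t)) / t) (𝓝[>] 0)
        (𝓝 0) by simpa using tendsto_finsetSum _ this
    intro k hk
    have h0 : pr P k = 0 :=
      le_antisymm (not_lt.1 (mt mem_posCat.2 (Finset.mem_compl.1 hk))) measureReal_nonneg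
    have hcell (a y : Bool) : Tendsto (fun t : ℝ => mass (Q t) (k, a, y) / t) (𝓝[>] 0) (𝓝 0) := by
      have hz : mass P (k, a, y) = 0 := mass_eq_zero_of_pr_eq_zero h0
      simpa [hz] using h.tendsto_mass (k, a, y)
    have hbound := ((hcell true true).add (hcell true false)).add
      ((hcell false true).add (hcell false false))
    simp only [add_zero] at hbound
    refine squeeze_zero_norm' (hpos.mono fun t ht => ?_) hbound
    rw [Real.norm_eq_abs, abs_div, abs_of_pos ht, ← add_div, ← add_div, ← add_div]
    exact div_le_div_of_nonneg_right (abs_catEffect_le k (mass_nonneg (Q t))) ht.le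
  have hsum := hmain.add hnull
  rw [add_zero, posDeriv_apply P fun z hz => by rw [mass_eq_zero_of_pr_eq_zero hz, mul_zero]] at hsum
  refine hsum.congr fun t => ?_
  have := h.1 t
  rw [add_sub_cancel, ate_eq_posEffect P, ate_eq_sum_catEffect (Q t), ← Finset.sum_div,
    ← Finset.sum_add_sum_compl (posCat P), posEffect, posEffect, smul_eq_mul]
  ring

/-- Every function of mean zero is a score. -/
lemma mem_tangentSet {d : ℕ} {P : Measure (Obs d)} [IsProbabilityMeasure P] {f : Obs d → ℝ}
    (hf : ∫ z, f z ∂P = 0) : f ∈ tangentSet P := by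
  classical
  -- The linear tilt is a probability density for small `t`, since `f` is bounded on a finite space;
  -- other `t` do not affect the limit.
  let Q : ℝ → Measure (Obs d) := fun t =>
    if ∀ z, 0 ≤ 1 + t * f z then P.withDensity fun z => ENNReal.ofReal (1 + t * f z) else P
  have hQ : ∀ t, IsProbabilityMeasure (Q t) := by
    intro t
    by_cases ht : ∀ z, 0 ≤ 1 + t * f z
    · simp only [Q, if_pos ht]
      refine ⟨?_⟩
      rw [withDensity_apply _ MeasurableSet.univ, Measure.restrict_univ,
        ← ofReal_integral_eq_lintegral_ofReal .of_finite (.of_forall ht),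
        integral_add .of_finite .of_finite, integral_const_mul, hf]
      simp
    · simp only [Q, if_neg ht]
      infer_instance
  have hev : ∀ᶠ t : ℝ in 𝓝[>] 0, ∀ z, 0 ≤ 1 + t * f z := by
    refine nhdsWithin_le_nhds (eventually_all.2 fun z => ?_)
    have : Tendsto (fun t : ℝ => 1 + t * f z) (𝓝 0) (𝓝 1) := by
      have : Continuous fun t : ℝ => 1 + t * f z := by fun_prop
      simpa using this.tendsto 0
    exact (this.eventually (lt_mem_nhds one_pos)).mono fun t ht => ht.le
  refine ⟨Q, hQ, ?_⟩
  suffices ∀ z : Obs d, Tendsto (fun t : ℝ =>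
      ((√((Q t).real {z}) - √(P.real {z})) / t - f z / 2 * √(P.real {z})) ^ 2) (𝓝[>] 0) (𝓝 0) by
    simpa using tendsto_finsetSum Finset.univ fun z _ => this z
  intro z
  have hder : HasDerivAt (fun t : ℝ => √(1 + t * f z)) (f z / 2) 0 := by
    have h1 : HasDerivAt (fun t : ℝ => 1 + t * f z) (f z) 0 := by
      simpa using ((hasDerivAt_id (0 : ℝ)).mul_const (f z)).const_add 1
    simpa using h1.sqrt (by simp)
  have hslope := ((hder.tendsto_slope_zero_right.mul_const (√(P.real {z}))).sub_const
    (f z / 2 * √(P.real {z}))).pow 2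
  rw [sub_self, zero_pow two_ne_zero] at hslope
  refine hslope.congr' (hev.mono fun t ht => ?_)
  have hmass : (Q t).real {z} = (1 + t * f z) * P.real {z} := by
    simp only [Q, if_pos ht]
    rw [measureReal_def, withDensity_apply _ (measurableSet_singleton z), lintegral_singleton,
      ENNReal.toReal_mul, ENNReal.toReal_ofReal (ht z), measureReal_def]
  simp only [hmass, Real.sqrt_mul (ht z), zero_add, zero_mul, add_zero, Real.sqrt_one, smul_eq_mul]
  ring

lemma isEfficientInfluenceFunction_phi {d : ℕ} {P : Measure (Obs d)} [IsProbabilityMeasure P]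
    (ha : ∀ k, 0 < pr P k → ∀ a, 0 < armMass (mass P) k a) :
    IsEfficientInfluenceFunction ate P fun z => phi P z - ate P := by
  have hmean : ∫ z, (phi P z - ate P) ∂P = 0 := by
    rw [integral_sub .of_finite .of_finite, integral_phi ha]
    simp
  refine ⟨⟨hmean, fun Q s h => ?_⟩, Submodule.subset_span (mem_tangentSet hmean)⟩
  -- The centring constant drops out because scores have mean zero.
  have hint : ∫ z, (phi P z - ate P) * s z ∂P = ∑ z, phi P z * (s z * mass P z) := by
    rw [integral_eq_sum_mass]
    simp only [sub_mul, mul_assoc, Finset.sum_sub_distrib, ← Finset.mul_sum, h.sum_score,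
      mul_zero, sub_zero]
  rw [hint]
  exact h.tendsto_ate ha

/-! ### Asymptotic normality -/

/-- The linearization error in the delta method is negligible. -/
lemma tendstoInMeasure_linearization_error {E Ω : Type*} [NormedAddCommGroup E] [NormedSpace ℝ E]
    [MeasurableSpace Ω] {ρ : Measure Ω} [IsFiniteMeasure ρ] {F : E → ℝ} {L : E →L[ℝ] ℝ} {p : E}
    (hF : HasFDerivAt F L p) {T : ℕ → Ω → E}
    (hT : ∀ γ : ℝ, 0 < γ → ∃ M : ℝ, 0 < M ∧
      ∀ n : ℕ, ρ.real {ω | M ≤ √(n : ℝ) * ‖T n ω - p‖} ≤ γ) :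
    TendstoInMeasure ρ
      (fun (n : ℕ) ω => √(n : ℝ) * (F (T n ω) - F p - L (T n ω - p))) atTop 0 := by
  rw [tendstoInMeasure_iff_measureReal_norm]
  intro ε hε
  rw [Metric.tendsto_atTop]
  intro γ hγ
  obtain ⟨M, hM, hTM⟩ := hT (γ / 2) (half_pos hγ)
  -- With slope `ε / M`, the scaled remainder is below `ε` wherever `√n * ‖T n ω - p‖ < M`; `M / η ≤
  -- √n` puts such points in the `η`-ball.
  obtain ⟨η, hη, hball⟩ := Metric.eventually_nhds_iff.1
    ((hasFDerivAt_iff_isLittleO.1 hF).bound (div_pos hε hM))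
  have hsqrt : Tendsto (fun n : ℕ => √(n : ℝ)) atTop atTop :=
    Real.tendsto_sqrt_atTop.comp tendsto_natCast_atTop_atTop
  obtain ⟨N, hN⟩ := eventually_atTop.1 (hsqrt.eventually_ge_atTop (M / η))
  refine ⟨N, fun n hn => ?_⟩
  rw [Real.dist_eq, sub_zero, abs_of_nonneg measureReal_nonneg]
  refine (measureReal_mono fun ω hω => ?_).trans_lt ((hTM n).trans_lt (half_lt_self hγ))
  simp only [Set.mem_ofPred_eq, Pi.zero_apply, sub_zero] at hω ⊢
  by_contra! hlt
  have hpos : 0 < √(n : ℝ) := (div_pos hM hη).trans_le (hN n hn)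
  have hclose : dist (T n ω) p < η := by
    rw [dist_eq_norm]
    have h1 := (div_le_iff₀ hη).1 (hN n hn)
    exact lt_of_mul_lt_mul_left (hlt.trans_le h1) hpos.le
  have hb := hball hclose
  rw [norm_mul, Real.norm_of_nonneg hpos.le] at hω
  have h2 : ε ≤ ε / M * (√(n : ℝ) * ‖T n ω - p‖) := by
    calc ε ≤ _ := hω
      _ ≤ √(n : ℝ) * (ε / M * ‖T n ω - p‖) := mul_le_mul_of_nonneg_left hb hpos.le
      _ = _ := by ring
  have h3 : ε / M * (√(n : ℝ) * ‖T n ω - p‖) < ε / M * M :=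
    mul_lt_mul_of_pos_left hlt (div_pos hε hM)
  rw [div_mul_cancel₀ _ hM.ne'] at h3
  linarith

variable {d : ℕ} {P : Measure (Obs d)} {Ω : Type*} [MeasurableSpace Ω] {ρ : Measure Ω}
  {Z : ℕ → Ω → Obs d}

lemma freq_eq_zero {z : ℕ → Obs d} (hz : ∀ i, pr P (z i).1 ≠ 0) (n : ℕ) (w : Obs d)
    (hw : pr P w.1 = 0) : freq (fun i : Fin n => z i) w = 0 := by
  have h (i : Fin n) : z i ≠ w := fun h => hz i (h ▸ hw)
  simp [freq, h]

lemma freq_eq_sum_indicator {n : ℕ} (z : ℕ → Obs d) (w : Obs d) :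
    freq (fun i : Fin n => z i) w
      = (n : ℝ)⁻¹ * ∑ i ∈ Finset.range n, ({w} : Set (Obs d)).indicator 1 (z i) := by
  classical
  rw [freq, div_eq_inv_mul, Finset.card_filter, Nat.cast_sum,
    Finset.sum_range fun i => ({w} : Set (Obs d)).indicator (1 : Obs d → ℝ) (z i)]
  simp [Set.indicator_apply]

lemma sum_mul_freq {n : ℕ} (f : Obs d → ℝ) (z : ℕ → Obs d) :
    ∑ w, f w * freq (fun i : Fin n => z i) w
      = (n : ℝ)⁻¹ * ∑ i ∈ Finset.range n, f (z i) := by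
  classical
  simp only [freq_eq_sum_indicator, Finset.mul_sum]
  rw [Finset.sum_comm]
  refine Finset.sum_congr rfl fun i _ => ?_
  simp [Set.indicator_apply, mul_comm]

variable [IsProbabilityMeasure P]

lemma ae_pr_ne_zero (hlaw : ∀ i, HasLaw (Z i) P ρ) : ∀ᵐ ω ∂ρ, ∀ i, pr P (Z i ω).1 ≠ 0 := by
  rw [ae_all_iff]
  intro i
  rw [(hlaw i).ae_iff (p := fun z => pr P z.1 ≠ 0) .of_discrete, ae_iff_of_countable]
  intro z hz h0
  exact hz ((measureReal_eq_zero_iff).1 (mass_eq_zero_of_pr_eq_zero h0))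

lemma memLp_comp_of_hasLaw {X : Ω → Obs d} (hX : HasLaw X P ρ) (f : Obs d → ℝ) :
    MemLp (fun ω => f (X ω)) 2 ρ := by
  have h : MemLp f 2 (ρ.map X) := by
    rw [hX.map_eq]
    exact .of_discrete
  exact h.comp_of_map hX.aemeasurable

variable [IsProbabilityMeasure ρ]

/-- Chebyshev's inequality for one cell frequency. -/
lemma measureReal_freq_sub_mass_ge_le (hlaw : ∀ i, HasLaw (Z i) P ρ) (hindep : iIndepFun Z ρ)
    (w : Obs d) (n : ℕ) {M : ℝ} (hM : 0 < M) :
    ρ.real {ω | M ≤ √(n : ℝ) * |freq (fun i : Fin n => Z i ω) w - mass P w|} ≤ 1 / M ^ 2 := by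
  rcases Nat.eq_zero_or_pos n with rfl | hn
  · simp only [Nat.cast_zero, Real.sqrt_zero, zero_mul, hM.not_ge, Set.ofPred_false,
      measureReal_empty]
    positivity
  have hn' : (0 : ℝ) < n := by exact_mod_cast hn
  set g : Obs d → ℝ := ({w} : Set (Obs d)).indicator 1 with hg
  have hgm : Measurable g := .of_discrete
  have hg01 (z : Obs d) : g z ∈ Set.Icc (0 : ℝ) 1 := by
    by_cases h : z = w <;> simp [hg, h]
  have hL (i : ℕ) : MemLp (fun ω => g (Z i ω)) 2 ρ :=
    memLp_comp_of_hasLaw (hlaw i) g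
  have hvar (i : ℕ) : Var[fun ω => g (Z i ω); ρ] ≤ 1 := by
    refine (variance_le_sq_of_bounded (a := 0) (b := 1) (.of_forall fun ω => hg01 _)
      (hL i).aemeasurable).trans (by norm_num)
  have hmean (i : ℕ) : ∫ ω, g (Z i ω) ∂ρ = mass P w := by
    refine ((hlaw i).integral_comp hgm.aestronglyMeasurable).trans ?_
    rw [hg, integral_indicator_one (measurableSet_singleton w)]
    rfl
  have hindep' : iIndepFun (fun i ω => g (Z i ω)) ρ := hindep.comp (fun _ => g) fun _ => hgm
  set S : Ω → ℝ := ∑ i ∈ Finset.range n, fun ω => g (Z i ω) with hS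
  have hSL : MemLp S 2 ρ := memLp_finsetSum' _ fun i _ => hL i
  have hSvar : Var[S; ρ] ≤ n := by
    rw [hS, IndepFun.variance_sum (fun i _ => hL i) fun i _ j _ hij => hindep'.indepFun hij]
    exact (Finset.sum_le_card_nsmul _ _ 1 fun i _ => hvar i).trans (by simp)
  have hSmean : ∫ ω, S ω ∂ρ = n * mass P w := by
    simp only [hS, Finset.sum_apply]
    rw [integral_finsetSum _ fun i _ => (hL i).integrable one_le_two]
    simp [hmean]
  have hcheb := meas_ge_le_variance_div_sq hSL (mul_pos (Real.sqrt_pos.2 hn') hM)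
  have hset : {ω | M ≤ √(n : ℝ) * |freq (fun i : Fin n => Z i ω) w - mass P w|}
      = {ω | √(n : ℝ) * M ≤ |S ω - ∫ ω, S ω ∂ρ|} := by
    ext ω
    have h1 : S ω - ∫ ω, S ω ∂ρ
        = √(n : ℝ) * (√(n : ℝ) * (freq (fun i : Fin n => Z i ω) w - mass P w)) := by
      rw [hSmean, freq_eq_sum_indicator (fun i => Z i ω), ← mul_assoc,
        Real.mul_self_sqrt hn'.le, mul_sub, mul_inv_cancel_left₀ hn'.ne', hS, Finset.sum_apply]
    rw [Set.mem_ofPred_eq, Set.mem_ofPred_eq, h1, abs_mul, abs_mul,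
      abs_of_pos (Real.sqrt_pos.2 hn'), mul_le_mul_iff_right₀ (Real.sqrt_pos.2 hn')]
  rw [hset, measureReal_def]
  refine (ENNReal.toReal_le_of_le_ofReal
    (div_nonneg (variance_nonneg _ _) (sq_nonneg _)) hcheb).trans ?_
  rw [mul_pow, Real.sq_sqrt hn'.le, ← div_div]
  exact div_le_div_of_nonneg_right (div_le_one_of_le₀ hSvar hn'.le) (sq_nonneg M)

/-- The normalized vector of cell frequencies is tight. -/
lemma exists_measureReal_norm_freq_sub_mass_ge_le (hlaw : ∀ i, HasLaw (Z i) P ρ)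
    (hindep : iIndepFun Z ρ) {γ : ℝ} (hγ : 0 < γ) :
    ∃ M : ℝ, 0 < M ∧ ∀ n : ℕ,
      ρ.real {ω | M ≤ √(n : ℝ) * ‖freq (fun i : Fin n => Z i ω) - mass P‖} ≤ γ := by
  -- The union bound over cells costs the factor `c`, so `M` is chosen with `c / M ^ 2 < γ`.
  set c : ℝ := (Fintype.card (Obs d) : ℝ)
  have hlim : Tendsto (fun M : ℝ => c * (1 / M ^ 2)) atTop (𝓝 0) := by
    simpa using (tendsto_pow_atTop (two_ne_zero) |>.inv_tendsto_atTop).const_mul c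
  obtain ⟨M, hMγ, hM⟩ := ((hlim.eventually (gt_mem_nhds hγ)).and (eventually_gt_atTop 0)).exists
  refine ⟨M, hM, fun n => le_trans ?_ hMγ.le⟩
  calc ρ.real {ω | M ≤ √(n : ℝ) * ‖freq (fun i : Fin n => Z i ω) - mass P‖}
      ≤ ρ.real (⋃ w ∈ (Finset.univ : Finset (Obs d)),
          {ω | M ≤ √(n : ℝ) * |freq (fun i : Fin n => Z i ω) w - mass P w|}) := by
        refine measureReal_mono (fun ω hω => ?_) (measure_ne_top _ _)
        by_contra hcon
        simp only [Set.mem_iUnion, Set.mem_ofPred_eq, Finset.mem_univ, exists_prop, true_and,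
          not_exists, not_le] at hcon hω
        rcases (Real.sqrt_nonneg (n : ℝ)).eq_or_lt with h0 | h0
        · rw [← h0, zero_mul] at hω
          exact hω.not_gt hM
        · refine hω.not_gt ?_
          rw [← lt_div_iff₀' h0, pi_norm_lt_iff (div_pos hM h0)]
          exact fun w => (lt_div_iff₀' h0).2 (hcon w)
    _ ≤ ∑ w : Obs d, ρ.real
          {ω | M ≤ √(n : ℝ) * |freq (fun i : Fin n => Z i ω) w - mass P w|} :=
        measureReal_biUnion_finset_le _ _
    _ ≤ c * (1 / M ^ 2) := by
        refine (Finset.sum_le_card_nsmul _ _ (1 / M ^ 2) fun w _ =>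
          measureReal_freq_sub_mass_ge_le hlaw hindep w n hM).trans ?_
        rw [nsmul_eq_mul]
        rfl

/-- The central limit theorem for the averages of `phi P`. -/
lemma tendstoInDistribution_sum_phi
    (ha : ∀ k, 0 < pr P k → ∀ a, 0 < armMass (mass P) k a)
    (hlaw : ∀ i, HasLaw (Z i) P ρ) (hindep : iIndepFun Z ρ) :
    TendstoInDistribution
      (fun (n : ℕ) ω => (√(n : ℝ))⁻¹ * (∑ i ∈ Finset.range n, phi P (Z i ω) - n * ate P))
      atTop (id : ℝ → ℝ) (fun _ => ρ) (gaussianReal 0 (Var[phi P; P]).toNNReal) := by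
  have hm : Measurable (phi P) := .of_discrete
  have hmean : ∫ ω, phi P (Z 0 ω) ∂ρ = ate P := by
    rw [← integral_phi ha]
    exact (hlaw 0).integral_comp hm.aestronglyMeasurable
  have hvar : Var[fun ω => phi P (Z 0 ω); ρ] = Var[phi P; P] := by
    have h := variance_map (μ := ρ) (X := phi P) hm.aemeasurable (hlaw 0).aemeasurable
    rw [(hlaw 0).map_eq] at h
    exact h.symm
  have := tendstoInDistribution_inv_sqrt_mul_sum_sub (X := fun i ω => phi P (Z i ω)) (P := ρ)
    (Y := (id : ℝ → ℝ)) (P' := gaussianReal 0 (Var[phi P; P]).toNNReal)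
    (by rw [hvar]; exact .id) (memLp_comp_of_hasLaw (hlaw 0) (phi P))
    (hindep.comp (fun _ => phi P) fun _ => hm)
    fun i => IdentDistrib.comp ⟨(hlaw i).aemeasurable, (hlaw 0).aemeasurable, by
      rw [(hlaw i).map_eq, (hlaw 0).map_eq]⟩ hm
  rwa [hmean] at this

lemma tendstoInDistribution_ateHat
    (ha : ∀ k, 0 < pr P k → ∀ a, 0 < armMass (mass P) k a)
    (hlaw : ∀ i, HasLaw (Z i) P ρ) (hindep : iIndepFun Z ρ) :
    TendstoInDistribution
      (fun (n : ℕ) (ω : Ω) => √(n : ℝ) * (ateHat (fun i : Fin n => Z i ω) - ate P))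
      atTop (id : ℝ → ℝ) (fun _ => ρ) (gaussianReal 0 (Var[phi P; P]).toNNReal) := by
  refine tendstoInDistribution_of_tendstoInMeasure_sub _ _
    (tendstoInDistribution_sum_phi ha hlaw hindep) ?_ fun n => ?_
  -- Almost surely, `√n` times the error of `ateHat` minus the normalized sum of `phi P` is exactly
  -- the linearization error of `posEffect P`.
  · refine (tendstoInMeasure_linearization_error (hasFDerivAt_posEffect ha)
      fun γ hγ => exists_measureReal_norm_freq_sub_mass_ge_le hlaw hindep hγ).congr_left fun n => ?_
    filter_upwards [ae_pr_ne_zero hlaw] with ω hω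
    rw [map_sub, posDeriv_mass ha, posDeriv_apply P (freq_eq_zero hω n),
      sum_mul_freq (phi P) fun i => Z i ω, ← ate_eq_posEffect,
      ← sum_catEffect_eq_posEffect P (freq_eq_zero hω n), ← ateHat_eq_sum_catEffect,
      Pi.sub_apply, Pi.sub_apply]
    rcases Nat.eq_zero_or_pos n with rfl | hn
    · simp
    have hn' : (0 : ℝ) < √n := Real.sqrt_pos.2 (by exact_mod_cast hn)
    have hsq : (n : ℝ) = √n * √n := (Real.mul_self_sqrt n.cast_nonneg).symm
    generalize √(n : ℝ) = r at *
    rw [hsq]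
    field_simp
  · have hZ : AEMeasurable (fun ω (i : Fin n) => Z i ω) ρ :=
      aemeasurable_pi_lambda _ fun i => (hlaw i).aemeasurable
    have hf : Measurable fun z : Fin n → Obs d => √(n : ℝ) * (ateHat z - ate P) :=
      measurable_of_finite _
    exact hf.comp_aemeasurable hZ

end

end DiscreteATE

open DiscreteATE
theorem theorem7 {d : ℕ} (P : Measure (Obs d)) [IsProbabilityMeasure P]
    (ε : ℝ) (hε₀ : 0 < ε) (hε₁ : ε < 1 / 2) (hP : Positivity ε P)
    {Ω : Type*} [MeasurableSpace Ω] (ρ : Measure Ω) [IsProbabilityMeasure ρ]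
    (Z : ℕ → Ω → Obs d) (hlaw : ∀ i, HasLaw (Z i) P ρ) (hindep : iIndepFun Z ρ) :
    TendstoInDistribution
      (fun (n : ℕ) (ω : Ω) => √(n : ℝ) * (ateHat (fun i : Fin n => Z i ω) - ate P))
      atTop (id : ℝ → ℝ) (fun _ => ρ) (gaussianReal 0 (Var[phi P; P]).toNNReal) ∧
    IsEfficientInfluenceFunction ate P (fun z => phi P z - ate P) := by
  have ha : ∀ k, 0 < pr P k → ∀ a, 0 < armMass (mass P) k a := fun k hk =>
    armMass_pos hε₀ hP hk
  exact ⟨tendstoInDistribution_ateHat ha hlaw hindep, isEfficientInfluenceFunction_phi ha⟩
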